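/- Let $A$ be a coherent quantale, i.e. a complete lattice with least element $0$ and greatest element $1$, together with an associative commutative multiplication with unit $1$ that distributes over arbitrary joins, such that every element is a join of compact elements, $1$ is compact, and the product of two compact elements is compact. An element $p<1$ of a commutative quantale whose unit is its greatest element $1$ is *$m$-prime* if $ab\le p$ implies $a\le p$ or $b\le p$. Let $\mathrm{Spec}(A)$ be the set of $m$-prime elements, $\mathrm{Min}(A)$ the set of minimal elements of $\mathrm{Spec}(A)$, and $V(a)=\{p\in\mathrm{Spec}(A): a\le p\}$. Such a quantale is an *mp-quantale* if for every $m$-prime $p$ there is a unique minimal $m$-prime $q$ with $q\le p$; an *mp-frame* is an mp-quantale whose multiplication is the meet. Put $\rho(a)=\bigwedge\{p\in\mathrm{Spec}(A): a\le p\}$. Let $R(A)=\{a\in A:\rho(a)=a\}$, with the order inherited from $A$, joins $\rho(\bigvee_i a_i)$ and the meet as multiplication, and let $[\rho(0))=\{x\in A:\rho(0)\le x\}$, with the order inherited from $A$ and the multiplication $x\cdot y=xy\vee\rho(0)$. The Zariski topology on $\mathrm{Spec}(A)$ has the sets $V(a)$, $a\in A$, as its closed sets. $\mathrm{Spec}_F(A)$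 is the set $\mathrm{Spec}(A)$ with the flat topology, which has the complements of the Zariski-compact Zariski-open sets as a basis of open sets, and $\mathrm{Min}_F(A)$ is $\mathrm{Min}(A)$ with the subspace topology of $\mathrm{Spec}_F(A)$. The following are equivalent: 1. $A$ is an mp-quantale; 2. for any distinct $p,q\in\mathrm{Min}(A)$ we have $p\vee q=1$; 3. $R(A)$ is an mp-frame; 4. $[\rho(0))$ is an mp-quantale; 5. the inclusion $\mathrm{Min}_F(A)\subseteq\mathrm{Spec}_F(A)$ has a continuous retraction, i.e. there is a continuous map $r:\mathrm{Spec}_F(A)\to\mathrm{Min}_F(A)$ with $r(p)=p$ for all $p\in\mathrm{Min}(A)$; 6. $\mathrm{Spec}_F(A)$ is normal, i.e. any two disjoint closed subsets have disjoint open neighbourhoods (no separation of points is assumed); 7. for every $p\in\mathrm{Min}(A)$ the set $V(p)$ is closed in $\mathrm{Spec}_F(A)$. -/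

import Mathlib

namespace QuantaleSpectrum

/-- A (commutative, unital) quantale is integral if the multiplicative unit is the top element. -/
class IsIntegralQuantale (A : Type*) [CommMonoid A] [CompleteLattice A] : Prop where
  one_eq_top : (1 : A) = ⊤

/-- A coherent quantale: every element is a join of compact elements, the top element `1` is
compact, and the compact elements are closed under multiplication. -/
structure IsCoherentQuantale (A : Type*) [CommMonoid A] [CompleteLattice A] : Prop where
  algebraic : ∀ a : A, ∃ X : Set A, (∀ c ∈ X, IsCompactElement c) ∧ a = sSup X
  compact_one : IsCompactElement (1 : A)
  compact_mul : ∀ c d : A, IsCompactElement c → IsCompactElement d → IsCompactElement (c * d)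

section Basic

variable {A : Type*} [CommMonoid A] [CompleteLattice A]

/-- `m`-prime elements. -/
structure IsMPrime (p : A) : Prop where
  lt_one : p < 1
  le_or_le : ∀ a b : A, a * b ≤ p → a ≤ p ∨ b ≤ p

/-- Minimal `m`-prime elements, i.e. the members of `Min(A)`. -/
def IsMinMPrime (q : A) : Prop := Minimal (IsMPrime (A := A)) q

/-- The radical `ρ(a)`: the meet of all `m`-prime elements above `a`. -/
def radical (a : A) : A := sInf {p : A | IsMPrime p ∧ a ≤ p}

end Basic

/-- An `mp`-quantale: every `m`-prime element lies above a unique minimal `m`-prime element. -/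
def IsMpQuantale (A : Type*) [CommMonoid A] [CompleteLattice A] [IsQuantale A]
    [IsIntegralQuantale A] : Prop :=
  ∀ p : A, IsMPrime p → ∃! q : A, IsMinMPrime q ∧ q ≤ p

/-- A quantale is a frame if its multiplication is the meet. -/
def IsFrameQuantale (A : Type*) [CommMonoid A] [CompleteLattice A] [IsQuantale A] : Prop :=
  ∀ a b : A, a * b = a ⊓ b

/-- An `mp`-frame is an `mp`-quantale which is a frame. -/
def IsMpFrame (A : Type*) [CommMonoid A] [CompleteLattice A] [IsQuantale A]
    [IsIntegralQuantale A] : Prop :=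
  IsMpQuantale A ∧ IsFrameQuantale A

section Integral

variable {A : Type*} [CommMonoid A] [CompleteLattice A]

theorem le_radical (a : A) : a ≤ radical a := le_sInf fun _ h => h.2

theorem radical_mono {a b : A} (h : a ≤ b) : radical a ≤ radical b :=
  sInf_le_sInf fun _ hp => ⟨hp.1, h.trans hp.2⟩

theorem radical_le_iff {a p : A} (hp : IsMPrime p) : radical a ≤ p ↔ a ≤ p :=
  ⟨(le_radical a).trans, fun h => sInf_le ⟨hp, h⟩⟩

theorem radical_idem (a : A) : radical (radical a) = radical a :=
  le_antisymm (le_sInf fun _ hp => (radical_le_iff hp.1).2 ((radical_le_iff hp.1).2 hp.2))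
    (le_radical _)

theorem radical_eq_of_le {a : A} (h : radical a ≤ a) : radical a = a :=
  le_antisymm h (le_radical a)

variable [IsQuantale A] [IsIntegralQuantale A]

theorem mul_le_left_factor (a b : A) : a * b ≤ a := by
  calc a * b ≤ a * 1 := by
        gcongr
        rw [IsIntegralQuantale.one_eq_top]; exact le_top
    _ = a := mul_one a

theorem mul_le_right_factor (a b : A) : a * b ≤ b := by
  rw [mul_comm]; exact mul_le_left_factor b a

end Integral

section Radical

variable (A : Type*) [CommMonoid A] [CompleteLattice A]

/-- The set `R(A)` of radical elements of `A`, i.e. those with `ρ(a) = a`. -/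
def RadicalElements : Type _ := {a : A // radical a = a}

instance : PartialOrder (RadicalElements A) :=
  inferInstanceAs (PartialOrder {a : A // radical a = a})

/-- The order on `R(A)` is inherited from `A`; joins are the radicals of the joins in `A` and
meets are the meets of `A`. -/
instance : CompleteLattice (RadicalElements A) where
  sup x y := ⟨radical (x.1 ⊔ y.1), radical_idem _⟩
  le_sup_left x y := (le_sup_left (a := x.1) (b := y.1)).trans (le_radical _)
  le_sup_right x y := (le_sup_right (a := x.1) (b := y.1)).trans (le_radical _)
  sup_le x y z hx hy := (radical_mono (sup_le (c := z.1) hx hy)).trans_eq z.2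
  inf x y := ⟨x.1 ⊓ y.1, radical_eq_of_le (le_inf
    ((radical_mono inf_le_left).trans_eq x.2) ((radical_mono inf_le_right).trans_eq y.2))⟩
  inf_le_left x y := inf_le_left (a := x.1) (b := y.1)
  inf_le_right x y := inf_le_right (a := x.1) (b := y.1)
  le_inf x y z hy hz := show x.1 ≤ y.1 ⊓ z.1 from le_inf hy hz
  sSup S := ⟨radical (sSup (Subtype.val '' S)), radical_idem _⟩
  sInf S := ⟨sInf (Subtype.val '' S), radical_eq_of_le (le_sInf (by
    rintro _ ⟨x, hx, rfl⟩
    exact (radical_mono (b := x.1) (sInf_le (Set.mem_image_of_mem Subtype.val hx))).trans_eq x.2))⟩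
  isLUB_sSup S := ⟨fun x hx => (le_sSup (Set.mem_image_of_mem Subtype.val hx)).trans (le_radical _),
    fun z hz => (radical_mono (b := z.1)
      (sSup_le (by rintro _ ⟨x, hx, rfl⟩; exact hz hx))).trans_eq z.2⟩
  isGLB_sInf S := ⟨fun x hx => sInf_le (Set.mem_image_of_mem Subtype.val hx),
    fun z hz => show z.1 ≤ sInf (Subtype.val '' S) from
      le_sInf (by rintro _ ⟨x, hx, rfl⟩; exact hz hx)⟩
  top := ⟨⊤, radical_eq_of_le le_top⟩
  le_top x := le_top (a := x.1)
  bot := ⟨radical ⊥, radical_idem _⟩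
  bot_le x := (radical_mono (bot_le (a := x.1))).trans_eq x.2

/-- The multiplication of `R(A)` is the meet. -/
instance : CommMonoid (RadicalElements A) where
  mul x y := x ⊓ y
  mul_assoc := inf_assoc
  mul_comm := inf_comm
  one := ⊤
  one_mul := top_inf_eq
  mul_one := inf_top_eq

instance : IsIntegralQuantale (RadicalElements A) := ⟨rfl⟩

theorem radicalElements_mul_sSup [IsQuantale A] [IsIntegralQuantale A]
    (x : RadicalElements A) (S : Set (RadicalElements A)) : x * sSup S = ⨆ y ∈ S, x * y := by
  refine le_antisymm ?_ (iSup₂_le fun y hy => inf_le_inf_left x (le_sSup hy))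
  generalize ht : (⨆ y ∈ S, x * y) = t
  have key : ∀ y ∈ S, x * y ≤ t := fun y hy => ht ▸ le_iSup₂ (f := fun y _ => x * y) y hy
  change x.1 ⊓ radical (sSup (Subtype.val '' S)) ≤ t.1
  rw [← t.2]
  refine le_sInf fun p ⟨hp, htp⟩ => ?_
  by_cases hx : x.1 ≤ p
  · exact inf_le_left.trans hx
  · refine inf_le_right.trans ((radical_le_iff hp).2 (sSup_le ?_))
    rintro _ ⟨y, hy, rfl⟩
    have h1 : x.1 * y.1 ≤ x.1 ⊓ y.1 :=
      le_inf (mul_le_left_factor _ _) (mul_le_right_factor _ _)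
    have h2 : x.1 ⊓ y.1 ≤ t.1 := key y hy
    exact (hp.le_or_le _ _ (h1.trans (h2.trans htp))).resolve_left hx

instance [IsQuantale A] [IsIntegralQuantale A] : IsQuantale (RadicalElements A) where
  mul_sSup_distrib := radicalElements_mul_sSup A
  sSup_mul_distrib S x := by
    rw [mul_comm, radicalElements_mul_sSup]
    simp only [mul_comm]

end Radical

section Interval

variable {A : Type*} [CommMonoid A] [CompleteLattice A]

/-- The interval `[a) = {x ∈ A | a ≤ x}`. -/
def Above (a : A) : Type _ := {x : A // a ≤ x}

variable (a : A)

instance : PartialOrder (Above a) := inferInstanceAs (PartialOrder {x : A // a ≤ x})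

/-- The order on `[a)` is inherited from `A`. -/
instance : CompleteLattice (Above a) where
  sup x y := ⟨x.1 ⊔ y.1, x.2.trans le_sup_left⟩
  le_sup_left x y := le_sup_left (a := x.1) (b := y.1)
  le_sup_right x y := le_sup_right (a := x.1) (b := y.1)
  sup_le x y z hx hy := sup_le (c := z.1) hx hy
  inf x y := ⟨x.1 ⊓ y.1, le_inf x.2 y.2⟩
  inf_le_left x y := inf_le_left (a := x.1) (b := y.1)
  inf_le_right x y := inf_le_right (a := x.1) (b := y.1)
  le_inf x y z hy hz := show x.1 ≤ y.1 ⊓ z.1 from le_inf hy hz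
  sSup S := ⟨sSup (Subtype.val '' S) ⊔ a, le_sup_right⟩
  sInf S := ⟨sInf (Subtype.val '' S), le_sInf (by rintro _ ⟨x, _, rfl⟩; exact x.2)⟩
  isLUB_sSup S := ⟨fun x hx => (le_sSup (Set.mem_image_of_mem Subtype.val hx)).trans le_sup_left,
    fun z hz => sup_le (c := z.1) (sSup_le (by rintro _ ⟨x, hx, rfl⟩; exact hz hx)) z.2⟩
  isGLB_sInf S := ⟨fun x hx => sInf_le (Set.mem_image_of_mem Subtype.val hx),
    fun z hz => show z.1 ≤ sInf (Subtype.val '' S) from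
      le_sInf (by rintro _ ⟨x, hx, rfl⟩; exact hz hx)⟩
  top := ⟨⊤, le_top⟩
  le_top x := le_top (a := x.1)
  bot := ⟨a, le_rfl⟩
  bot_le x := x.2

variable [IsQuantale A] [IsIntegralQuantale A]

open Quantale in
theorem sup_mul_sup_assoc (x y z : A) : ((x * y) ⊔ a) * z ⊔ a = x * ((y * z) ⊔ a) ⊔ a := by
  rw [sup_mul_distrib, mul_sup_distrib, sup_assoc, sup_assoc,
    sup_eq_right.2 (mul_le_left_factor a z), sup_eq_right.2 (mul_le_right_factor x a), mul_assoc]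

/-- The multiplication of `[a)` is `x ·ₐ y = x y ∨ a`, with unit the top element. -/
instance : CommMonoid (Above a) where
  mul x y := ⟨x.1 * y.1 ⊔ a, le_sup_right⟩
  mul_assoc x y z := Subtype.ext (sup_mul_sup_assoc a x.1 y.1 z.1)
  mul_comm x y := Subtype.ext (congrArg (· ⊔ a) (mul_comm x.1 y.1))
  one := ⊤
  one_mul x := Subtype.ext (by
    change (⊤ : A) * x.1 ⊔ a = x.1
    rw [← IsIntegralQuantale.one_eq_top, one_mul]; exact sup_eq_left.2 x.2)
  mul_one x := Subtype.ext (by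
    change x.1 * (⊤ : A) ⊔ a = x.1
    rw [← IsIntegralQuantale.one_eq_top, mul_one]; exact sup_eq_left.2 x.2)

instance : IsIntegralQuantale (Above a) := ⟨rfl⟩

open Quantale in
theorem above_mul_sSup (x : Above a) (S : Set (Above a)) : x * sSup S = ⨆ y ∈ S, x * y := by
  have mono : ∀ y z : Above a, y ≤ z → x * y ≤ x * z := fun y z h =>
    sup_le_sup_right (mul_le_mul_right (show y.1 ≤ z.1 from h) x.1) a
  refine le_antisymm ?_ (iSup₂_le fun y hy => mono _ _ (le_sSup hy))
  generalize ht : (⨆ y ∈ S, x * y) = t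
  have key : ∀ y ∈ S, x * y ≤ t := fun y hy => ht ▸ le_iSup₂ (f := fun y _ => x * y) y hy
  change x.1 * (sSup (Subtype.val '' S) ⊔ a) ⊔ a ≤ t.1
  rw [mul_sup_distrib, mul_sSup_distrib]
  refine sup_le (sup_le (iSup₂_le ?_) ((mul_le_right_factor _ _).trans t.2)) t.2
  rintro _ ⟨y, hy, rfl⟩
  exact le_sup_left.trans (show x.1 * y.1 ⊔ a ≤ t.1 from key y hy)

instance : IsQuantale (Above a) where
  mul_sSup_distrib := above_mul_sSup a
  sSup_mul_distrib S x := by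
    rw [mul_comm, above_mul_sSup]
    simp only [mul_comm]

end Interval

section Spectrum

variable (A : Type*) [CommMonoid A] [CompleteLattice A]

/-- The set `Spec(A)` of `m`-prime elements; as a topological space it is `Spec_Z(A)`. -/
def Spec : Type _ := {p : A // IsMPrime p}

variable {A} in
/-- `V(a) = {p ∈ Spec(A) | a ≤ p}`. -/
def V (a : A) : Set (Spec A) := {p | a ≤ p.1}

/-- `Min(A)` as a subset of `Spec(A)`. -/
def minSpec : Set (Spec A) := {p | IsMinMPrime p.1}

/-- The Zariski topology on `Spec(A)`: the closed sets are exactly the sets `V(a)`, `a ∈ A`. -/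
instance [IsQuantale A] [IsIntegralQuantale A] : TopologicalSpace (Spec A) :=
  TopologicalSpace.ofClosed (Set.range (V (A := A)))
    ⟨1, Set.eq_empty_of_forall_notMem fun p hp => not_le_of_gt p.2.lt_one hp⟩
    (fun T hT => ⟨sSup {a : A | V a ∈ T}, by
      ext p
      constructor
      · intro hp s hs
        obtain ⟨a, rfl⟩ := hT hs
        exact (le_sSup (show a ∈ {a : A | V a ∈ T} from hs)).trans hp
      · intro hp
        exact sSup_le fun a ha => hp (V a) ha⟩)
    (by
      rintro _ ⟨a, rfl⟩ _ ⟨b, rfl⟩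
      refine ⟨a * b, ?_⟩
      ext p
      constructor
      · exact p.2.le_or_le a b
      · rintro (h | h)
        · exact (mul_le_left_factor a b).trans h
        · exact (mul_le_right_factor a b).trans h)

/-- The flat topology associated with a spectral space `X`: it has the complements of the compact
open subsets of `X` as a basis. -/
@[reducible] def flatTopology (X : Type*) [TopologicalSpace X] : TopologicalSpace X :=
  TopologicalSpace.generateFrom {s | ∃ U : Set X, IsOpen U ∧ IsCompact U ∧ s = Uᶜ}

/-- The space `Spec_F(A)`: the set `Spec(A)` with the flat topology. -/
def FlatSpec : Type _ := Spec A

instance [IsQuantale A] [IsIntegralQuantale A] : TopologicalSpace (FlatSpec A) :=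
  flatTopology (Spec A)

variable {A} in
/-- `V(a)` as a subset of `Spec_F(A)`. -/
def flatV (a : A) : Set (FlatSpec A) := V a

/-- The space `Min_F(A)`: the set `Min(A)` with the subspace topology inherited from
`Spec_F(A)`. -/
def FlatMin : Type _ := {p : FlatSpec A // p ∈ minSpec A}

instance [IsQuantale A] [IsIntegralQuantale A] : TopologicalSpace (FlatMin A) :=
  inferInstanceAs (TopologicalSpace {p : FlatSpec A // p ∈ minSpec A})

variable {A} in
/-- The inclusion `Min_F(A) ⊆ Spec_F(A)`. -/
def FlatMin.incl (p : FlatMin A) : FlatSpec A := p.1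

end Spectrum

end QuantaleSpectrum

open QuantaleSpectrum

/-!
In the flat topology a prime `p` specializes to a prime `q` exactly when `q ≤ p`, so the closed
points of `Spec_F(A)` are the minimal primes and each condition on `A` turns into a topological one.
The conditions obtained are equivalent in every compact T₀ space in which two points that cannot be
separated by neighbourhoods have a common generization. Both compactness and this last property of
`Spec_F(A)` come from one construction: for an ultrafilter `F` on `Spec(A)` the element
`⋁ {a | V(a) ∈ F}` is again an `m`-prime, and a compact element `c` lies below it if and only if
`V(c) ∈ F`. The passage from `A` to `R(A)` and to `[ρ(0))` does not change the ordered set of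
`m`-primes.
-/

namespace QuantaleSpectrum

open Filter TopologicalSpace Topology

section ClosedPoints

variable {X : Type*} [TopologicalSpace X]

theorem exists_mem_closedPoints_specializes [CompactSpace X] [T0Space X] (x : X) :
    ∃ p ∈ closedPoints X, x ⤳ p := by
  obtain ⟨p, hxp, hp⟩ :=
    (isClosed_closure (s := {x})).exists_closed_singleton (Set.singleton_nonempty x).closure
  exact ⟨p, hp, specializes_iff_mem_closure.2 hxp⟩

theorem eq_of_specializes_of_mem_closedPoints {p q : X} (hp : p ∈ closedPoints X) (h : p ⤳ q) :
    q = p :=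
  h.mem_closed hp rfl

theorem mem_closedPoints_iff_forall_specializes {p : X} :
    p ∈ closedPoints X ↔ ∀ q, p ⤳ q → q = p := by
  refine ⟨fun hp _ ↦ eq_of_specializes_of_mem_closedPoints hp, fun h ↦ ?_⟩
  exact isClosed_of_closure_subset fun q hq ↦ h q (specializes_iff_mem_closure.2 hq)

theorem pairwiseDisjoint_nhds_closedPoints
    (hgen : ∀ x y : X, ¬Disjoint (𝓝 x) (𝓝 y) → ∃ z, z ⤳ x ∧ z ⤳ y)
    (h : ∀ x : X, ∃! p, p ∈ closedPoints X ∧ x ⤳ p) :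
    (closedPoints X).PairwiseDisjoint 𝓝 := by
  intro p hp q hq hpq
  by_contra hdisj
  obtain ⟨z, hzp, hzq⟩ := hgen p q hdisj
  exact hpq ((h z).unique ⟨hp, hzp⟩ ⟨hq, hzq⟩)

theorem normalSpace_of_pairwiseDisjoint_nhds_closedPoints [CompactSpace X] [T0Space X]
    (h : (closedPoints X).PairwiseDisjoint 𝓝) : NormalSpace X := by
  refine ⟨fun s t hs ht hst ↦ separatedNhds_iff_disjoint.2 ?_⟩
  refine hs.isCompact.disjoint_nhdsSet_left.2 fun x hx ↦
    ht.isCompact.disjoint_nhdsSet_right.2 fun y hy ↦ ?_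
  obtain ⟨p, hp, hxp⟩ := exists_mem_closedPoints_specializes x
  obtain ⟨q, hq, hyq⟩ := exists_mem_closedPoints_specializes y
  have hpq : p ≠ q := hst.ne_of_mem (hxp.mem_closed hs hx) (hyq.mem_closed ht hy)
  exact (h hp hq hpq).mono hxp hyq

theorem continuous_of_forall_specializes_mem_closedPoints [NormalSpace X]
    {r : X → closedPoints X} (hr : ∀ x : X, x ⤳ (r x : X)) : Continuous r := by
  refine continuous_induced_rng.2 (continuous_iff_continuousAt.2 fun x ↦ ?_)
  refine (nhds_basis_opens (r x : X)).tendsto_right_iff.2 fun U ⟨hxU, hU⟩ ↦ ?_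
  obtain ⟨V, W, hV, hW, hxV, hUW, hVW⟩ :=
    normal_separation (r x).2 hU.isClosed_compl (by simpa using hxU)
  filter_upwards [hV.mem_nhds ((hr x).mem_open hV (hxV rfl))] with y hyV
  by_contra hyU
  exact Set.disjoint_left.1 hVW hyV ((hr y).mem_open hW (hUW hyU))

theorem exists_continuous_retraction_closedPoints [CompactSpace X] [T0Space X] [NormalSpace X] :
    ∃ r : X → closedPoints X, Continuous r ∧ ∀ p : closedPoints X, r p = p := by
  choose f hf hspec using exists_mem_closedPoints_specializes (X := X)
  let r : X → closedPoints X := fun x ↦ ⟨f x, hf x⟩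
  exact ⟨r, continuous_of_forall_specializes_mem_closedPoints (r := r) hspec,
    fun p ↦ Subtype.ext (eq_of_specializes_of_mem_closedPoints p.2 (hspec p))⟩

theorem retraction_eq_iff_specializes [CompactSpace X] [T0Space X] {r : X → closedPoints X}
    (hr : Continuous r) (hfix : ∀ p : closedPoints X, r p = p) (x : X) (p : closedPoints X) :
    r x = p ↔ x ⤳ p := by
  have eq_of_specializes (q : closedPoints X) (hxq : x ⤳ q) : r x = q := by
    have hspec : (r x : X) ⤳ q := by
      simpa only [Function.comp_apply, hfix] using hxq.map (continuous_subtype_val.comp hr)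
    exact Subtype.ext (eq_of_specializes_of_mem_closedPoints (r x).2 hspec).symm
  refine ⟨?_, eq_of_specializes p⟩
  rintro rfl
  obtain ⟨q, hq, hxq⟩ := exists_mem_closedPoints_specializes x
  rwa [eq_of_specializes ⟨q, hq⟩ hxq]

theorem isClosed_setOf_specializes_of_retraction [CompactSpace X] [T0Space X]
    {r : X → closedPoints X} (hr : Continuous r) (hfix : ∀ p : closedPoints X, r p = p)
    {p : X} (hp : p ∈ closedPoints X) : IsClosed {x | x ⤳ p} := by
  have hpre : {x | x ⤳ p} = (fun x ↦ (r x : X)) ⁻¹' {p} := by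
    ext x
    exact (retraction_eq_iff_specializes hr hfix x ⟨p, hp⟩).symm.trans Subtype.ext_iff
  rw [hpre]
  exact IsClosed.preimage (continuous_subtype_val.comp hr) hp

theorem existsUnique_specializes_of_isClosed_setOf_specializes [CompactSpace X] [T0Space X]
    (h : ∀ p ∈ closedPoints X, IsClosed {x | x ⤳ p}) (x : X) :
    ∃! p, p ∈ closedPoints X ∧ x ⤳ p := by
  obtain ⟨p, hp, hxp⟩ := exists_mem_closedPoints_specializes x
  refine ⟨p, ⟨hp, hxp⟩, fun q ⟨hq, hxq⟩ ↦ ?_⟩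
  have hqp : q ⤳ p := hxq.mem_closed (h p hp) hxp
  exact (eq_of_specializes_of_mem_closedPoints hq hqp).symm

theorem normalSpace_tfae [CompactSpace X] [T0Space X]
    (hgen : ∀ x y : X, ¬Disjoint (𝓝 x) (𝓝 y) → ∃ z, z ⤳ x ∧ z ⤳ y) :
    List.TFAE [
      ∀ x : X, ∃! p, p ∈ closedPoints X ∧ x ⤳ p,
      (closedPoints X).PairwiseDisjoint 𝓝,
      NormalSpace X,
      ∃ r : X → closedPoints X, Continuous r ∧ ∀ p : closedPoints X, r p = p,
      ∀ p ∈ closedPoints X, IsClosed {x | x ⤳ p}] := by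
  tfae_have 1 → 2 := pairwiseDisjoint_nhds_closedPoints hgen
  tfae_have 2 → 3 := normalSpace_of_pairwiseDisjoint_nhds_closedPoints
  tfae_have 3 → 4 := fun _ ↦ exists_continuous_retraction_closedPoints
  tfae_have 4 → 5 := fun ⟨_, hr, hfix⟩ _ ↦ isClosed_setOf_specializes_of_retraction hr hfix
  tfae_have 5 → 1 := existsUnique_specializes_of_isClosed_setOf_specializes
  tfae_finish

theorem isTopologicalBasis_flatTopology :
    @IsTopologicalBasis X (flatTopology X) {s | ∃ U : Set X, IsOpen U ∧ IsCompact U ∧ s = Uᶜ} := by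
  refine @isTopologicalBasis_of_subbasis_of_finiteInter X (flatTopology X) _ rfl
    ⟨⟨∅, isOpen_empty, isCompact_empty, Set.compl_empty.symm⟩, ?_⟩
  rintro _ ⟨U, hU, hUc, rfl⟩ _ ⟨W, hW, hWc, rfl⟩
  exact ⟨U ∪ W, hU.union hW, hUc.union hWc, (Set.compl_union U W).symm⟩

end ClosedPoints

section MPrime

variable {A : Type*} [CommMonoid A] [CompleteLattice A]

theorem IsMPrime.not_one_le {p : A} (hp : IsMPrime p) : ¬1 ≤ p := hp.lt_one.not_ge

theorem IsMPrime.radical_eq {p : A} (hp : IsMPrime p) : radical p = p :=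
  radical_eq_of_le ((radical_le_iff hp).2 le_rfl)

theorem isMin_iff_isMinMPrime (q : {p : A // IsMPrime p}) : IsMin q ↔ IsMinMPrime q.1 :=
  ⟨fun h ↦ ⟨q.2, fun p hp hpq ↦ h (b := ⟨p, hp⟩) hpq⟩, fun h p hpq ↦ h.2 p.2 hpq⟩

theorem radical_inf_radical_le (a b : A) : radical a ⊓ radical b ≤ radical (a * b) :=
  le_sInf fun _ ⟨hp, hab⟩ ↦ (hp.le_or_le a b hab).elim
    (fun ha ↦ inf_le_left.trans ((radical_le_iff hp).2 ha))
    fun hb ↦ inf_le_right.trans ((radical_le_iff hp).2 hb)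

variable [IsQuantale A] [IsIntegralQuantale A]

theorem isMpQuantale_iff_existsUnique_isMin :
    IsMpQuantale A ↔ ∀ p : {p : A // IsMPrime p}, ∃! q, IsMin q ∧ q ≤ p := by
  simp only [isMin_iff_isMinMPrime, Subtype.forall]
  refine forall₂_congr fun p hp ↦ ⟨?_, ?_⟩
  · rintro ⟨q, hq, huniq⟩
    exact ⟨⟨q, hq.1.1⟩, hq, fun q' hq' ↦ Subtype.ext (huniq q' hq')⟩
  · rintro ⟨q, hq, huniq⟩
    exact ⟨q, hq, fun q' hq' ↦ congrArg Subtype.val (huniq ⟨q', hq'.1.1⟩ hq')⟩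

open Quantale in
theorem sup_mul_sup_le (a b c : A) : (a ⊔ c) * (b ⊔ c) ≤ a * b ⊔ c := by
  rw [sup_mul_distrib, mul_sup_distrib]
  exact sup_le (sup_le_sup_left (mul_le_right_factor a c) _)
    ((mul_le_left_factor c _).trans le_sup_right)

theorem isMPrime_of_isCoatom {m : A} (hm : IsCoatom m) : IsMPrime m where
  lt_one := by
    rw [IsIntegralQuantale.one_eq_top]
    exact hm.lt_top
  le_or_le a b hab := by
    by_contra! h
    have sup_eq_one {x : A} (hx : ¬x ≤ m) : x ⊔ m = 1 := by
      rw [IsIntegralQuantale.one_eq_top]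
      exact hm.2 _ (right_lt_sup.2 hx)
    have hone : (1 : A) ≤ m := calc
      1 = (a ⊔ m) * (b ⊔ m) := by rw [sup_eq_one h.1, sup_eq_one h.2, mul_one]
      _ ≤ a * b ⊔ m := sup_mul_sup_le a b m
      _ = m := sup_eq_right.2 hab
    rw [IsIntegralQuantale.one_eq_top] at hone
    exact hm.1 (top_le_iff.1 hone)

end MPrime

section PrimeTransfer

theorem isMpQuantale_congr {A B : Type*} [CommMonoid A] [CompleteLattice A] [IsQuantale A]
    [IsIntegralQuantale A] [CommMonoid B] [CompleteLattice B] [IsQuantale B]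
    [IsIntegralQuantale B] (e : {p : A // IsMPrime p} ≃o {p : B // IsMPrime p}) :
    IsMpQuantale A ↔ IsMpQuantale B := by
  rw [isMpQuantale_iff_existsUnique_isMin, isMpQuantale_iff_existsUnique_isMin]
  refine e.toEquiv.forall_congr fun p ↦ e.toEquiv.existsUnique_congr fun q ↦ ?_
  exact and_congr (e.isMin_apply).symm e.le_iff_le.symm

variable {A : Type*} [CommMonoid A] [CompleteLattice A] [IsQuantale A] [IsIntegralQuantale A]

theorem RadicalElements.isMPrime_iff (x : RadicalElements A) : IsMPrime x ↔ IsMPrime x.1 := by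
  have hlt : x < 1 ↔ x.1 < 1 := by
    rw [IsIntegralQuantale.one_eq_top, IsIntegralQuantale.one_eq_top]
    exact Iff.rfl
  constructor
  · refine fun hx ↦ ⟨hlt.1 hx.lt_one, fun a b hab ↦ ?_⟩
    have hmul : radical a ⊓ radical b ≤ x.1 :=
      (radical_inf_radical_le a b).trans ((radical_mono hab).trans_eq x.2)
    exact (hx.le_or_le ⟨radical a, radical_idem a⟩ ⟨radical b, radical_idem b⟩ hmul).imp
      (le_radical a).trans (le_radical b).trans
  · refine fun hx ↦ ⟨hlt.2 hx.lt_one, fun y z (hyz : y.1 ⊓ z.1 ≤ x.1) ↦ ?_⟩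
    exact hx.le_or_le y.1 z.1
      ((le_inf (mul_le_left_factor _ _) (mul_le_right_factor _ _)).trans hyz)

theorem Above.isMPrime_iff {a : A} (x : Above a) : IsMPrime x ↔ IsMPrime x.1 := by
  have hlt : x < 1 ↔ x.1 < 1 := by
    rw [IsIntegralQuantale.one_eq_top, IsIntegralQuantale.one_eq_top]
    exact Iff.rfl
  constructor
  · refine fun hx ↦ ⟨hlt.1 hx.lt_one, fun b c hbc ↦ ?_⟩
    have hmul : (b ⊔ a) * (c ⊔ a) ⊔ a ≤ x.1 :=
      sup_le ((sup_mul_sup_le b c a).trans (sup_le hbc x.2)) x.2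
    exact (hx.le_or_le ⟨b ⊔ a, le_sup_right⟩ ⟨c ⊔ a, le_sup_right⟩ hmul).imp
      le_sup_left.trans le_sup_left.trans
  · refine fun hx ↦ ⟨hlt.2 hx.lt_one, fun y z (hyz : y.1 * z.1 ⊔ a ≤ x.1) ↦ ?_⟩
    exact hx.le_or_le y.1 z.1 (le_sup_left.trans hyz)

/-- The `m`-primes of `R(A)` are those of `A`. -/
def RadicalElements.mPrimeOrderIso :
    {x : RadicalElements A // IsMPrime x} ≃o {p : A // IsMPrime p} where
  toFun x := ⟨x.1.1, (isMPrime_iff x.1).1 x.2⟩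
  invFun p := ⟨⟨p.1, p.2.radical_eq⟩, (isMPrime_iff _).2 p.2⟩
  left_inv _ := rfl
  right_inv _ := rfl
  map_rel_iff' := Iff.rfl

/-- If `a` lies below every `m`-prime, then the `m`-primes of `[a)` are those of `A`. -/
def Above.mPrimeOrderIso {a : A} (ha : ∀ p : A, IsMPrime p → a ≤ p) :
    {x : Above a // IsMPrime x} ≃o {p : A // IsMPrime p} where
  toFun x := ⟨x.1.1, (isMPrime_iff x.1).1 x.2⟩
  invFun p := ⟨⟨p.1, ha p.1 p.2⟩, (isMPrime_iff _).2 p.2⟩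
  left_inv _ := rfl
  right_inv _ := rfl
  map_rel_iff' := Iff.rfl

theorem isMpFrame_radicalElements_iff : IsMpFrame (RadicalElements A) ↔ IsMpQuantale A :=
  (and_iff_left fun _ _ ↦ rfl).trans (isMpQuantale_congr RadicalElements.mPrimeOrderIso)

theorem isMpQuantale_above_iff {a : A} (ha : ∀ p : A, IsMPrime p → a ≤ p) :
    IsMpQuantale (Above a) ↔ IsMpQuantale A :=
  isMpQuantale_congr (Above.mPrimeOrderIso ha)

end PrimeTransfer

section UltrafilterLimit

variable {A : Type*} [CommMonoid A] [CompleteLattice A]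

theorem V_antitone : Antitone (V : A → Set (Spec A)) := fun _ _ hab _ hp ↦ hab.trans hp

theorem V_one : V (1 : A) = ∅ :=
  Set.eq_empty_of_forall_notMem fun p hp ↦ p.2.not_one_le hp

theorem V_finset_sup {ι : Type*} (t : Finset ι) (f : ι → A) :
    V (t.sup f) = ⋂ i ∈ t, V (f i) := by
  ext p
  simp only [V, Set.mem_ofPred_eq, Finset.sup_le_iff, Set.mem_iInter]

theorem V_mul [IsQuantale A] [IsIntegralQuantale A] (a b : A) : V (a * b) = V a ∪ V b :=
  Set.Subset.antisymm (fun p ↦ p.2.le_or_le a b) <| Set.union_subset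
    (V_antitone (mul_le_left_factor a b)) (V_antitone (mul_le_right_factor a b))

/-- The limit of an ultrafilter on `Spec(A)` in the constructible topology, i.e. the common
refinement of the Zariski and the flat topology. It is defined as an element of `A`, and is an
`m`-prime if `A` is coherent. -/
def ultrafilterLimit (F : Ultrafilter (Spec A)) : A := sSup {a | V a ∈ F}

theorem le_ultrafilterLimit_iff {F : Ultrafilter (Spec A)} {c : A} (hc : IsCompactElement c) :
    c ≤ ultrafilterLimit F ↔ V c ∈ F := by
  refine ⟨fun h ↦ ?_, fun h ↦ le_sSup h⟩
  obtain ⟨t, ht, hct⟩ :=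
    (CompleteLattice.isCompactElement_iff_exists_le_sSup_of_le_sSup A c).1 hc _ h
  have hVt : V (t.sup id) ∈ F := by
    rw [V_finset_sup]
    exact (biInter_finset_mem t).2 ht
  exact mem_of_superset hVt (V_antitone hct)

namespace IsCoherentQuantale

theorem le_iff_forall_compact (hA : IsCoherentQuantale A) {a b : A} :
    a ≤ b ↔ ∀ c, IsCompactElement c → c ≤ a → c ≤ b := by
  refine ⟨fun hab _ _ hca ↦ hca.trans hab, fun h ↦ ?_⟩
  obtain ⟨X, hX, rfl⟩ := hA.algebraic a
  exact sSup_le fun c hc ↦ h c (hX c hc) (le_sSup hc)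

theorem exists_compact_le_not_le (hA : IsCoherentQuantale A) {a b : A} (hab : ¬a ≤ b) :
    ∃ c, IsCompactElement c ∧ c ≤ a ∧ ¬c ≤ b := by
  simpa only [hA.le_iff_forall_compact (a := a), not_forall, exists_prop] using hab

variable [IsQuantale A] [IsIntegralQuantale A]

theorem isMPrime_ultrafilterLimit (hA : IsCoherentQuantale A) (F : Ultrafilter (Spec A)) :
    IsMPrime (ultrafilterLimit F) where
  lt_one := by
    refine lt_of_le_not_ge (le_top.trans_eq IsIntegralQuantale.one_eq_top.symm) fun h ↦ ?_
    rw [le_ultrafilterLimit_iff hA.compact_one, V_one] at h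
    exact F.empty_notMem h
  le_or_le a b hab := by
    by_contra! h
    obtain ⟨c, hc, hca, hcF⟩ := hA.exists_compact_le_not_le h.1
    obtain ⟨d, hd, hdb, hdF⟩ := hA.exists_compact_le_not_le h.2
    have hcd : c * d ≤ ultrafilterLimit F := (mul_le_mul' hca hdb).trans hab
    rw [le_ultrafilterLimit_iff (hA.compact_mul c d hc hd), V_mul, Ultrafilter.union_mem_iff,
      ← le_ultrafilterLimit_iff hc, ← le_ultrafilterLimit_iff hd] at hcd
    exact hcd.elim hcF hdF

theorem exists_isMPrime_ge (hA : IsCoherentQuantale A) {a : A} (ha : a ≠ 1) :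
    ∃ p, IsMPrime p ∧ a ≤ p := by
  have hcompact := hA.compact_one
  rw [IsIntegralQuantale.one_eq_top] at hcompact ha
  have := CompleteLattice.coatomic_of_top_compact hcompact
  obtain ⟨m, hm, ham⟩ := (eq_top_or_exists_le_coatom a).resolve_left ha
  exact ⟨m, isMPrime_of_isCoatom hm, ham⟩

end IsCoherentQuantale

end UltrafilterLimit

section FlatTopology

variable {A : Type*} [CommMonoid A] [CompleteLattice A] [IsQuantale A] [IsIntegralQuantale A]

theorem isOpen_iff_exists_eq_compl_V {U : Set (Spec A)} : IsOpen U ↔ ∃ a : A, U = (V a)ᶜ :=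
  ⟨fun ⟨a, ha⟩ ↦ ⟨a, by rw [ha, compl_compl]⟩, fun ⟨a, ha⟩ ↦ ⟨a, by rw [ha, compl_compl]⟩⟩

namespace IsCoherentQuantale

theorem isTopologicalBasis_compl_V (hA : IsCoherentQuantale A) :
    IsTopologicalBasis (Set.range fun c : {c : A // IsCompactElement c} ↦ (V c.1)ᶜ) := by
  refine isTopologicalBasis_of_isOpen_of_nhds ?_ fun p U hp hU ↦ ?_
  · rintro _ ⟨c, rfl⟩
    exact isOpen_iff_exists_eq_compl_V.2 ⟨c, rfl⟩
  · obtain ⟨a, rfl⟩ := isOpen_iff_exists_eq_compl_V.1 hU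
    obtain ⟨c, hc, hca, hcp⟩ := hA.exists_compact_le_not_le hp
    exact ⟨_, ⟨⟨c, hc⟩, rfl⟩, hcp, Set.compl_subset_compl.2 (V_antitone hca)⟩

theorem isCompact_compl_V (hA : IsCoherentQuantale A) {c : A} (hc : IsCompactElement c) :
    IsCompact (V c)ᶜ := by
  refine isCompact_iff_ultrafilter_le_nhds'.2 fun F hF ↦
    ⟨⟨ultrafilterLimit F, hA.isMPrime_ultrafilterLimit F⟩, ?_, ?_⟩
  · exact fun hcF ↦ Ultrafilter.compl_mem_iff_notMem.1 hF ((le_ultrafilterLimit_iff hc).1 hcF)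
  · refine hA.isTopologicalBasis_compl_V.nhds_hasBasis.ge_iff.2 ?_
    rintro _ ⟨⟨⟨d, hd⟩, rfl⟩, hdF⟩
    exact Ultrafilter.compl_mem_iff_notMem.2 fun h ↦ hdF ((le_ultrafilterLimit_iff hd).2 h)

theorem isOpen_and_isCompact_iff (hA : IsCoherentQuantale A) {U : Set (Spec A)} :
    IsOpen U ∧ IsCompact U ↔ ∃ c : A, IsCompactElement c ∧ U = (V c)ᶜ := by
  constructor
  · rintro ⟨hU, hUc⟩
    obtain ⟨s, hs, rfl⟩ := eq_finite_iUnion_of_isTopologicalBasis_of_isCompact_open _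
      hA.isTopologicalBasis_compl_V U hUc hU
    lift s to Finset {c : A // IsCompactElement c} using hs
    refine ⟨s.sup Subtype.val, CompleteLattice.isCompactElement_finsetSup s fun c _ ↦ c.2, ?_⟩
    simp only [V_finset_sup, Set.compl_iInter, Finset.mem_coe]
  · rintro ⟨c, hc, rfl⟩
    exact ⟨isOpen_iff_exists_eq_compl_V.2 ⟨c, rfl⟩, hA.isCompact_compl_V hc⟩

theorem nhds_flatSpec_hasBasis (hA : IsCoherentQuantale A) (x : FlatSpec A) :
    (𝓝 x).HasBasis (fun c : A ↦ IsCompactElement c ∧ c ≤ x.1) flatV := by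
  refine (@IsTopologicalBasis.nhds_hasBasis _ (flatTopology (Spec A)) _
    isTopologicalBasis_flatTopology x).to_hasBasis ?_ ?_
  · rintro _ ⟨⟨U, hU, hUc, rfl⟩, hx⟩
    obtain ⟨c, hc, rfl⟩ := hA.isOpen_and_isCompact_iff.1 ⟨hU, hUc⟩
    rw [compl_compl] at hx ⊢
    exact ⟨c, ⟨hc, hx⟩, subset_rfl⟩
  · rintro c ⟨hc, hcx⟩
    obtain ⟨hU, hUc⟩ := hA.isOpen_and_isCompact_iff.2 ⟨c, hc, rfl⟩
    exact ⟨_, ⟨⟨_, hU, hUc, (compl_compl _).symm⟩, hcx⟩, subset_rfl⟩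

theorem specializes_iff (hA : IsCoherentQuantale A) {x y : FlatSpec A} : x ⤳ y ↔ y.1 ≤ x.1 := by
  rw [(hA.nhds_flatSpec_hasBasis y).specializes_iff, hA.le_iff_forall_compact]
  exact forall_congr' fun _ ↦ and_imp

theorem t0Space_flatSpec (hA : IsCoherentQuantale A) : T0Space (FlatSpec A) :=
  ⟨fun _ _ h ↦ Subtype.ext
    (le_antisymm (hA.specializes_iff.1 h.specializes') (hA.specializes_iff.1 h.specializes))⟩

theorem compactSpace_flatSpec (hA : IsCoherentQuantale A) : CompactSpace (FlatSpec A) := by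
  refine ⟨isCompact_iff_ultrafilter_le_nhds'.2 fun F _ ↦
    ⟨⟨ultrafilterLimit F, hA.isMPrime_ultrafilterLimit F⟩, Set.mem_univ _, ?_⟩⟩
  exact (hA.nhds_flatSpec_hasBasis _).ge_iff.2 fun c ⟨hc, hcF⟩ ↦ (le_ultrafilterLimit_iff hc).1 hcF

theorem exists_common_generization (hA : IsCoherentQuantale A) (x y : FlatSpec A)
    (hxy : ¬Disjoint (𝓝 x) (𝓝 y)) : ∃ z, z ⤳ x ∧ z ⤳ y := by
  have : (𝓝 x ⊓ 𝓝 y).NeBot := neBot_iff.2 (disjoint_iff.not.1 hxy)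
  let F : Ultrafilter (FlatSpec A) := Ultrafilter.of (𝓝 x ⊓ 𝓝 y)
  let z : FlatSpec A := ⟨ultrafilterLimit F, hA.isMPrime_ultrafilterLimit F⟩
  have specializes_of_le_nhds {w : FlatSpec A} (hw : ↑F ≤ 𝓝 w) : z ⤳ w :=
    hA.specializes_iff.2 <| hA.le_iff_forall_compact.2 fun c hc hcw ↦
      (le_ultrafilterLimit_iff hc).2 (hw ((hA.nhds_flatSpec_hasBasis w).mem_of_mem ⟨hc, hcw⟩))
  have hF : ↑F ≤ 𝓝 x ⊓ 𝓝 y := Ultrafilter.of_le _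
  exact ⟨z, specializes_of_le_nhds (hF.trans inf_le_left),
    specializes_of_le_nhds (hF.trans inf_le_right)⟩

theorem disjoint_nhds_iff (hA : IsCoherentQuantale A) {x y : FlatSpec A} :
    Disjoint (𝓝 x) (𝓝 y) ↔ x.1 ⊔ y.1 = 1 := by
  constructor
  · intro hdisj
    by_contra hne
    obtain ⟨m, hm, hle⟩ := hA.exists_isMPrime_ge hne
    let z : FlatSpec A := ⟨m, hm⟩
    have hzx : z ⤳ x := hA.specializes_iff.2 (le_sup_left.trans hle)
    have hzy : z ⤳ y := hA.specializes_iff.2 (le_sup_right.trans hle)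
    exact (specializes_refl z).not_disjoint (hdisj.mono hzx hzy)
  · intro hsup
    by_contra hdisj
    obtain ⟨z, hzx, hzy⟩ := hA.exists_common_generization x y hdisj
    exact z.2.not_one_le <| hsup.ge.trans <|
      sup_le (hA.specializes_iff.1 hzx) (hA.specializes_iff.1 hzy)

theorem mem_closedPoints_iff_isMinMPrime (hA : IsCoherentQuantale A) {x : FlatSpec A} :
    x ∈ closedPoints (FlatSpec A) ↔ IsMinMPrime x.1 := by
  simp only [mem_closedPoints_iff_forall_specializes, hA.specializes_iff]
  exact ⟨fun h ↦ ⟨x.2, fun q hq hqx ↦ (congrArg Subtype.val (h ⟨q, hq⟩ hqx)).ge⟩,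
    fun h q hqx ↦ Subtype.ext (le_antisymm hqx (h.2 q.2 hqx))⟩

theorem minSpec_eq_closedPoints (hA : IsCoherentQuantale A) :
    minSpec A = closedPoints (FlatSpec A) :=
  Set.ext fun _ ↦ hA.mem_closedPoints_iff_isMinMPrime.symm

theorem isMpQuantale_iff_existsUnique_specializes (hA : IsCoherentQuantale A) :
    IsMpQuantale A ↔ ∀ x : FlatSpec A, ∃! p, p ∈ closedPoints (FlatSpec A) ∧ x ⤳ p := by
  simp only [hA.mem_closedPoints_iff_isMinMPrime, hA.specializes_iff,
    isMpQuantale_iff_existsUnique_isMin, isMin_iff_isMinMPrime]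
  exact Iff.rfl

theorem forall_isMinMPrime_sup_eq_one_iff (hA : IsCoherentQuantale A) :
    (∀ p q : A, IsMinMPrime p → IsMinMPrime q → p ≠ q → p ⊔ q = 1) ↔
      (closedPoints (FlatSpec A)).PairwiseDisjoint 𝓝 := by
  constructor
  · intro h x hx y hy hxy
    exact hA.disjoint_nhds_iff.2 <| h x.1 y.1 (hA.mem_closedPoints_iff_isMinMPrime.1 hx)
      (hA.mem_closedPoints_iff_isMinMPrime.1 hy) fun he ↦ hxy (Subtype.ext he)
  · intro h p q hp hq hpq
    exact hA.disjoint_nhds_iff.1 <| h (x := ⟨p, hp.1⟩) (y := ⟨q, hq.1⟩)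
      (hA.mem_closedPoints_iff_isMinMPrime.2 hp) (hA.mem_closedPoints_iff_isMinMPrime.2 hq)
      fun he ↦ hpq (congrArg Subtype.val he)

theorem exists_retraction_flatMin_iff (hA : IsCoherentQuantale A) :
    (∃ r : FlatSpec A → FlatMin A, Continuous r ∧ ∀ p : FlatMin A, r p.incl = p) ↔
      ∃ r : FlatSpec A → closedPoints (FlatSpec A),
        Continuous r ∧ ∀ p : closedPoints (FlatSpec A), r p = p := by
  rw [← hA.minSpec_eq_closedPoints]
  exact Iff.rfl

theorem forall_isClosed_flatV_iff (hA : IsCoherentQuantale A) :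
    (∀ p : A, IsMinMPrime p → IsClosed (flatV p)) ↔
      ∀ p ∈ closedPoints (FlatSpec A), IsClosed {x | x ⤳ p} := by
  simp only [hA.mem_closedPoints_iff_isMinMPrime, hA.specializes_iff]
  exact ⟨fun h p hp ↦ h p.1 hp, fun h p hp ↦ h ⟨p, hp.1⟩ hp⟩

end IsCoherentQuantale

end FlatTopology

end QuantaleSpectrum

theorem theorem8p14 {A : Type*} [CommMonoid A] [CompleteLattice A] [IsQuantale A]
    [IsIntegralQuantale A] (hA : IsCoherentQuantale A) :
    List.TFAE [
      IsMpQuantale A,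
      ∀ p q : A, IsMinMPrime p → IsMinMPrime q → p ≠ q → p ⊔ q = 1,
      IsMpFrame (RadicalElements A),
      IsMpQuantale (Above (radical (⊥ : A))),
      ∃ r : FlatSpec A → FlatMin A, Continuous r ∧ ∀ p : FlatMin A, r p.incl = p,
      NormalSpace (FlatSpec A),
      ∀ p : A, IsMinMPrime p → IsClosed (flatV p)] := by
  have := hA.compactSpace_flatSpec
  have := hA.t0Space_flatSpec
  have hflat := normalSpace_tfae hA.exists_common_generization
  rw [← hA.isMpQuantale_iff_existsUnique_specializes, ← hA.forall_isMinMPrime_sup_eq_one_iff,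
    ← hA.exists_retraction_flatMin_iff, ← hA.forall_isClosed_flatV_iff] at hflat
  tfae_have 1 ↔ 2 := hflat.out 0 1
  tfae_have 1 ↔ 3 := isMpFrame_radicalElements_iff.symm
  tfae_have 1 ↔ 4 := (isMpQuantale_above_iff fun _ hp ↦ (radical_le_iff hp).2 bot_le).symm
  tfae_have 1 ↔ 5 := hflat.out 0 3
  tfae_have 1 ↔ 6 := hflat.out 0 2
  tfae_have 1 ↔ 7 := hflat.out 0 4
  tfae_finish
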